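/- \textbf{Theorem (phase gap of the generalized Metropolis--Hastings walk operator).} Let $\Omega\subset\mathbb{R}^d$ be a finite set, let $P:\Omega\to(0,1)$ be a probability distribution on $\Omega$ and, for every $x\in\Omega$, let $T(x,\cdot):\Omega\to(0,1)$ be a probability distribution on $\Omega$. For $x,y\in\Omega$ put $$A(x,y)=\min\left\{1,\frac{P(y)T(y,x)}{P(x)T(x,y)}\right\},\qquad W_{x,y}=\begin{cases}T(x,y)A(x,y)& (x\ne y)\\ 1-\sum_{z\in\Omega\setminus\{x\}}T(x,z)A(x,z)& (x=y),\end{cases}$$ so that $W$ is the transition matrix of the Metropolis--Hastings chain. Let $\Delta=1-|\lambda_1|$ be its spectral gap, where $\lambda_1$ is the eigenvalue of $W$ of second largest modulus (eigenvalues counted with multiplicity). For $x\in\Omega$ let $\Delta\Omega_x=\{m\in\mathbb{R}^d : x+m\in\Omega\}$. Consider two registers $R_{\rm S},R_{\rm M}$, whose computational basis states are labelled by finite sets of vectors in $\mathbb{R}^d$ that contain $\Omega$ and $\bigcup_{x\in\Omega}\Delta\Omega_x$ respectively, and a qubit $R_{\rm C}$. Let $V$ (on $R_{\rm S},R_{\rm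 M}$), $S$ (on $R_{\rm M},R_{\rm C}$), and $B,F$ (on the whole system) be unitaries such that for all $x\in\Omega$ and $m\in\Delta\Omega_x$ $$V|x\rangle|0\rangle=\sum_{m'\in\Delta\Omega_x}\sqrt{T(x,x+m')}\,|x\rangle|m'\rangle,$$ $$B|x\rangle|m\rangle|\phi\rangle=|x\rangle|m\rangle\otimes\begin{pmatrix}\sqrt{1-a}&-\sqrt{a}\\ \sqrt{a}&\sqrt{1-a}\end{pmatrix}|\phi\rangle\quad\text{with } a=A(x,x+m),\ \text{for every state } |\phi\rangle \text{ of } R_{\rm C},$$ $$F|x\rangle|m\rangle|0\rangle=|x\rangle|m\rangle|0\rangle,\quad F|x\rangle|m\rangle|1\rangle=|x+m\rangle|m\rangle|1\rangle,\qquad S|m\rangle|0\rangle=|m\rangle|0\rangle,\quad S|m\rangle|1\rangle=|{-m}\rangle|1\rangle .$$ Their action on the remaining basis states is arbitrary, except that $V$ maps $\mathrm{span}\{|x\rangle|m\rangle : x\in\Omega,\ m \text{ any label of } R_{\rm M}\}$ into itself (which is automatic if $\Omega$ is the whole label set of $R_{\rm S}$, or if $V$ is controlled by $R_{\rm S}$).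 Let $R=2\,(I\otimes|0\rangle\langle0|\otimes|0\rangle\langle 0|)-I$ and $U=RV^\dagger B^\dagger SFBV$ (with $V$ and $S$ extended by the identity to the whole system). Let $$\mathcal{A}=\mathrm{span}\{|x\rangle|0\rangle|0\rangle : x\in\Omega\},\qquad \mathcal{B}=V^\dagger B^\dagger SFBV\mathcal{A},\qquad |P\rangle=\sum_{x\in\Omega}\sqrt{P(x)}\,|x\rangle|0\rangle|0\rangle .$$ Then $U$ maps $\mathcal{A}+\mathcal{B}$ into itself. On $\mathcal{A}+\mathcal{B}$, the vector $|P\rangle$ is, up to scalar multiples, the unique eigenvector of $U$ with eigenvalue $1$. Every other eigenvalue of $U$ on $\mathcal{A}+\mathcal{B}$ can be written as $e^{i\theta}$ with $\theta\in\mathbb{R}$, and every such $\theta$ satisfies $|\theta|\ge\arccos(1-\Delta)$. -/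

import Mathlib

open scoped Matrix Kronecker

noncomputable section

/-- The data of the Metropolis–Hastings algorithm on a finite state space `Ω ⊂ ℝ^d`:
a target distribution `P : Ω → (0,1)` and, for every `x ∈ Ω`, a proposal distribution
`T x : Ω → (0,1)`. Only the values of `P` and `T` at points of `Ω` matter. -/
structure MHChain (d : ℕ) where
  Ω : Finset (Fin d → ℝ)
  P : (Fin d → ℝ) → ℝ
  T : (Fin d → ℝ) → (Fin d → ℝ) → ℝ
  P_mem : ∀ x ∈ Ω, P x ∈ Set.Ioo (0 : ℝ) 1
  P_sum : ∑ x ∈ Ω, P x = 1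
  T_mem : ∀ x ∈ Ω, ∀ y ∈ Ω, T x y ∈ Set.Ioo (0 : ℝ) 1
  T_sum : ∀ x ∈ Ω, ∑ y ∈ Ω, T x y = 1

namespace MHChain

variable {d : ℕ} (C : MHChain d)

/-- The acceptance ratio `A(x,y)`. -/
def acc (x y : Fin d → ℝ) : ℝ :=
  min 1 (C.P y * C.T y x / (C.P x * C.T x y))

/-- The transition matrix `W` of the Markov chain; the row index is the current state. -/
def W : Matrix C.Ω C.Ω ℝ := Matrix.of fun x y =>
  if x = y then 1 - ∑ z ∈ C.Ω.erase x, C.T x z * C.acc x z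
  else C.T x y * C.acc x y

/-- The moduli of the complex eigenvalues of `W`, counted with algebraic multiplicity and
listed in decreasing order. -/
def eigenvalueModuli : List ℝ :=
  (((C.W.map (algebraMap ℝ ℂ)).charpoly.roots).map fun z => ‖z‖).sort (· ≥ ·)

/-- The spectral gap `Δ = 1 - |λ₁|`, with `λ₁` the eigenvalue of `W` of second largest modulus
(entry `1` of the list that starts with entry `0`; the list has at least two entries, because
`P x < 1` for all `x ∈ Ω` forces `Ω` to have at least two points). -/
def spectralGap : ℝ := 1 - C.eigenvalueModuli.getD 1 0

/-- The set `ΔΩ_x` of possible moves from `x`. -/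
def moves (x : Fin d → ℝ) : Finset (Fin d → ℝ) := C.Ω.image fun y => y - x

theorem mem_moves (x m : Fin d → ℝ) : m ∈ C.moves x ↔ x + m ∈ C.Ω := by
  simp only [moves, Finset.mem_image]
  constructor
  · rintro ⟨y, hy, rfl⟩
    simpa using hy
  · intro h
    exact ⟨x + m, h, by simp⟩

end MHChain

/-- The basis vector `|x⟩|m⟩` of two registers whose computational basis states are labelled by
the elements of `s` and `t`. -/
def ket₂ {d : ℕ} {s t : Finset (Fin d → ℝ)} (x m : Fin d → ℝ) : s × t → ℂ :=
  fun i => if (i.1 : Fin d → ℝ) = x ∧ (i.2 : Fin d → ℝ) = m then 1 else 0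

/-- The basis vector `|m⟩|c⟩` of a register and a qubit. -/
def ketQ {d : ℕ} {t : Finset (Fin d → ℝ)} (m : Fin d → ℝ) (c : Fin 2) : t × Fin 2 → ℂ :=
  fun i => if (i.1 : Fin d → ℝ) = m ∧ i.2 = c then 1 else 0

/-- The basis vector `|x⟩|m⟩|c⟩` of two registers and a qubit. -/
def ket₃ {d : ℕ} {s t : Finset (Fin d → ℝ)} (x m : Fin d → ℝ) (c : Fin 2) :
    s × t × Fin 2 → ℂ :=
  fun i => if (i.1 : Fin d → ℝ) = x ∧ (i.2.1 : Fin d → ℝ) = m ∧ i.2.2 = c then 1 else 0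

/-- An implementation of the building blocks of the quantum walk operator of a
Metropolis–Hastings chain. The registers `R_S` and `R_M` have computational basis states that
represent the vectors in the finite sets `SReg` and `MReg`; the former contains all states, the
latter all possible moves. The operators are any unitaries with the prescribed action on the basis
states that represent a state `x ∈ Ω` and a possible move from `x`; how they continue to the
remaining basis states is left free, except that `V` must not lead from a basis state with
`x ∈ Ω` on `R_S` to one with a non-state on `R_S` (an empty condition if `SReg = Ω`, and
satisfied if `V` is controlled by `R_S`). -/
structure WalkCircuit {d : ℕ} (C : MHChain d) where
  SReg : Finset (Fin d → ℝ)
  MReg : Finset (Fin d → ℝ)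
  states_subset : C.Ω ⊆ SReg
  moves_subset : ∀ x ∈ C.Ω, C.moves x ⊆ MReg
  /-- `V` acts on `R_S` and `R_M`. -/
  V : Matrix.unitaryGroup (SReg × MReg) ℂ
  V_apply : ∀ x ∈ C.Ω, (V : Matrix (SReg × MReg) (SReg × MReg) ℂ) *ᵥ ket₂ x 0 =
    ∑ m ∈ C.moves x, ((√(C.T x (x + m)) : ℝ) : ℂ) • ket₂ x m
  V_states : ∀ i j : SReg × MReg, (j.1 : Fin d → ℝ) ∈ C.Ω → (i.1 : Fin d → ℝ) ∉ C.Ω →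
    (V : Matrix (SReg × MReg) (SReg × MReg) ℂ) i j = 0
  /-- `B` rotates the qubit `R_C` under the control of `R_S` and `R_M`. -/
  B : Matrix.unitaryGroup (SReg × MReg × Fin 2) ℂ
  B_apply_zero : ∀ x ∈ C.Ω, ∀ m ∈ C.moves x,
    (B : Matrix (SReg × MReg × Fin 2) (SReg × MReg × Fin 2) ℂ) *ᵥ ket₃ x m 0 =
      ((√(1 - C.acc x (x + m)) : ℝ) : ℂ) • ket₃ x m 0 +
      ((√(C.acc x (x + m)) : ℝ) : ℂ) • ket₃ x m 1
  B_apply_one : ∀ x ∈ C.Ω, ∀ m ∈ C.moves x,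
    (B : Matrix (SReg × MReg × Fin 2) (SReg × MReg × Fin 2) ℂ) *ᵥ ket₃ x m 1 =
      (-((√(C.acc x (x + m)) : ℝ) : ℂ)) • ket₃ x m 0 +
      ((√(1 - C.acc x (x + m)) : ℝ) : ℂ) • ket₃ x m 1
  /-- `F` adds the move to the state under the control of `R_C`. -/
  F : Matrix.unitaryGroup (SReg × MReg × Fin 2) ℂ
  F_apply_zero : ∀ x ∈ C.Ω, ∀ m ∈ C.moves x,
    (F : Matrix (SReg × MReg × Fin 2) (SReg × MReg × Fin 2) ℂ) *ᵥ ket₃ x m 0 = ket₃ x m 0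
  F_apply_one : ∀ x ∈ C.Ω, ∀ m ∈ C.moves x,
    (F : Matrix (SReg × MReg × Fin 2) (SReg × MReg × Fin 2) ℂ) *ᵥ ket₃ x m 1 =
      ket₃ (x + m) m 1
  /-- `S` acts on `R_M` and `R_C`; it flips the sign of the move under the control of `R_C`. -/
  S : Matrix.unitaryGroup (MReg × Fin 2) ℂ
  S_apply_zero : ∀ x ∈ C.Ω, ∀ m ∈ C.moves x,
    (S : Matrix (MReg × Fin 2) (MReg × Fin 2) ℂ) *ᵥ ketQ m 0 = ketQ m 0
  S_apply_one : ∀ x ∈ C.Ω, ∀ m ∈ C.moves x,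
    (S : Matrix (MReg × Fin 2) (MReg × Fin 2) ℂ) *ᵥ ketQ m 1 = ketQ (-m) 1

namespace WalkCircuit

variable {d : ℕ} {C : MHChain d} (Q : WalkCircuit C)

/-- The computational basis of the whole system `R_S`, `R_M`, `R_C`. -/
abbrev Idx : Type := Q.SReg × Q.MReg × Fin 2

/-- `V ⊗ I` on the whole system. -/
def opV : Matrix Q.Idx Q.Idx ℂ :=
  Matrix.reindex (Equiv.prodAssoc _ _ _) (Equiv.prodAssoc _ _ _)
    ((Q.V : Matrix (Q.SReg × Q.MReg) (Q.SReg × Q.MReg) ℂ) ⊗ₖ (1 : Matrix (Fin 2) (Fin 2) ℂ))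

/-- `I ⊗ S` on the whole system. -/
def opS : Matrix Q.Idx Q.Idx ℂ :=
  (1 : Matrix Q.SReg Q.SReg ℂ) ⊗ₖ (Q.S : Matrix (Q.MReg × Fin 2) (Q.MReg × Fin 2) ℂ)

def opB : Matrix Q.Idx Q.Idx ℂ := (Q.B : Matrix _ _ ℂ)

def opF : Matrix Q.Idx Q.Idx ℂ := (Q.F : Matrix _ _ ℂ)

/-- The projection `Λ₀ = I ⊗ |0⟩⟨0| ⊗ |0⟩⟨0|`. -/
def proj₀ : Matrix Q.Idx Q.Idx ℂ :=
  Matrix.diagonal fun i => if (i.2.1 : Fin d → ℝ) = 0 ∧ i.2.2 = 0 then 1 else 0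

/-- The reflection `R = 2Λ₀ - I`. -/
def opR : Matrix Q.Idx Q.Idx ℂ := (2 : ℂ) • Q.proj₀ - 1

/-- `V† B† S F B V`. -/
def core : Matrix Q.Idx Q.Idx ℂ :=
  Q.opVᴴ * Q.opBᴴ * Q.opS * Q.opF * Q.opB * Q.opV

/-- The walk operator `U = R V† B† S F B V`. -/
def U : Matrix Q.Idx Q.Idx ℂ := Q.opR * Q.core

/-- `𝒜 = span {|x⟩|0⟩|0⟩ : x ∈ Ω}`. -/
def spaceA : Submodule ℂ (Q.Idx → ℂ) :=
  Submodule.span ℂ {v | ∃ x ∈ C.Ω, v = ket₃ x 0 0}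

/-- `ℬ = V† B† S F B V 𝒜`. -/
def spaceB : Submodule ℂ (Q.Idx → ℂ) := Q.spaceA.map Q.core.mulVecLin

/-- `|P⟩ = ∑ x, √P(x) |x⟩|0⟩|0⟩`. -/
def ketP : Q.Idx → ℂ := ∑ x ∈ C.Ω, ((√(C.P x) : ℝ) : ℂ) • ket₃ x 0 0

end WalkCircuit

end

/-!
On `𝒜 + ℬ` the walk operator is a product of two reflections: `G = V† B† S F B V` is a unitary
involution there, and `Λ₀` is the projection onto `𝒜`. Hence an eigenvalue `e^{iθ} ≠ ±1` of
`U = (2Λ₀ - 1) G` comes with an eigenvector in `𝒜`, with eigenvalue `cos θ`, of the compression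
`Λ₀ G` of `G` to `𝒜`.

On the proposals, `S F` fixes `|x⟩|y - x⟩|0⟩` and maps `|x⟩|y - x⟩|1⟩` to `|y⟩|x - y⟩|1⟩`, so it is
a Szegedy swap controlled by the acceptance qubit. The compression therefore has the matrix entries
`√(T(x,y) A(x,y)) √(T(y,x) A(y,x))` off the diagonal. By detailed balance, conjugation by `√P` turns
it into the transition matrix `W`. The fixed vectors of `U` thus correspond to the functions fixed
by `W`, which are the constants by the maximum principle, and the other eigenvalues `cos θ` of `W`
have modulus at most `1 - Δ`.
-/

section ReflectionPair

variable {𝕜 E : Type*} [Field 𝕜] [AddCommGroup E] [Module 𝕜 E]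

/-- The algebraic setting of a quantum walk: on `A + G A` the map `G` is an involution and `L` is a
projection onto `A`. -/
structure IsReflectionPair (L G : Module.End 𝕜 E) (A : Submodule 𝕜 E) : Prop where
  proj_apply : ∀ a ∈ A, L a = a
  proj_invol_mem : ∀ a ∈ A, L (G a) ∈ A
  invol_invol : ∀ a ∈ A, G (G a) = a

/-- The walk operator `(2L - 1) G` of a projection `L` and an involution `G`. -/
def reflectionWalk (L G : Module.End 𝕜 E) : Module.End 𝕜 E := ((2 : 𝕜) • L - 1) * G

theorem reflectionWalk_apply (L G : Module.End 𝕜 E) (v : E) :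
    reflectionWalk L G v = (2 : 𝕜) • L (G v) - G v := rfl

namespace IsReflectionPair

variable {L G : Module.End 𝕜 E} {A : Submodule 𝕜 E} {v : E}

theorem exists_eq_add (hv : v ∈ A ⊔ A.map G) : ∃ a ∈ A, ∃ b ∈ A, v = a + G b := by
  obtain ⟨a, ha, _, ⟨b, hb, rfl⟩, rfl⟩ := Submodule.mem_sup.mp hv
  exact ⟨a, ha, b, hb, rfl⟩

theorem proj_mem (h : IsReflectionPair L G A) (hv : v ∈ A ⊔ A.map G) : L v ∈ A := by
  obtain ⟨a, ha, b, hb, rfl⟩ := exists_eq_add hv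
  rw [map_add, h.proj_apply a ha]
  exact A.add_mem ha (h.proj_invol_mem b hb)

theorem invol_mem (h : IsReflectionPair L G A) (hv : v ∈ A ⊔ A.map G) : G v ∈ A ⊔ A.map G := by
  obtain ⟨a, ha, b, hb, rfl⟩ := exists_eq_add hv
  rw [map_add, h.invol_invol b hb, add_comm]
  exact Submodule.add_mem_sup hb (Submodule.mem_map_of_mem ha)

theorem invol_apply_apply (h : IsReflectionPair L G A) (hv : v ∈ A ⊔ A.map G) :
    G (G v) = v := by
  obtain ⟨a, ha, b, hb, rfl⟩ := exists_eq_add hv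
  simp only [map_add, h.invol_invol a ha, h.invol_invol b hb]

theorem reflectionWalk_mem (h : IsReflectionPair L G A) (hv : v ∈ A ⊔ A.map G) :
    reflectionWalk L G v ∈ A ⊔ A.map G :=
  Submodule.sub_mem _
    (Submodule.smul_mem _ _ (Submodule.mem_sup_left (h.proj_mem (h.invol_mem hv))))
    (h.invol_mem hv)

theorem invol_apply_of_reflectionWalk_eq_smul (h : IsReflectionPair L G A)
    (hv : v ∈ A ⊔ A.map G) {z : 𝕜} (hz : reflectionWalk L G v = z • v) :
    G v = z • ((2 : 𝕜) • L v - v) := by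
  rw [reflectionWalk_apply] at hz
  have hLG : L (G v) = z • L v := by
    have hLz := congrArg L hz
    rw [map_sub, map_smul, map_smul, h.proj_apply _ (h.proj_mem (h.invol_mem hv))] at hLz
    linear_combination (norm := module) hLz
  rw [hLG] at hz
  linear_combination (norm := module) -hz

theorem exists_compression_eigenvector [NeZero (2 : 𝕜)] (h : IsReflectionPair L G A)
    (hv : v ∈ A ⊔ A.map G) (hv0 : v ≠ 0) {z : 𝕜} (hz1 : z ^ 2 ≠ 1)
    (hz : reflectionWalk L G v = z • v) :
    ∃ p ∈ A, p ≠ 0 ∧ L (G p) = ((z + z⁻¹) / 2) • p := by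
  have hGv := h.invol_apply_of_reflectionWalk_eq_smul hv hz
  have hv_eq : v = z • ((2 : 𝕜) • G (L v) - z • ((2 : 𝕜) • L v - v)) := by
    rw [← hGv, ← map_smul, ← map_sub, ← map_smul, ← hGv, h.invol_apply_apply hv]
  have hz0 : z ≠ 0 := by
    rintro rfl
    exact hv0 (by rw [hv_eq, zero_smul])
  refine ⟨L v, h.proj_mem hv, fun hLv => ?_, ?_⟩
  · rw [hLv] at hv_eq
    have h0 : (1 - z ^ 2) • v = 0 := by
      simp only [map_zero] at hv_eq
      linear_combination (norm := module) hv_eq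
    exact (smul_ne_zero (sub_ne_zero.mpr hz1.symm) hv0) h0
  · have hLv_eq := congrArg L hv_eq
    simp only [map_smul, map_sub, h.proj_apply _ (h.proj_mem hv)] at hLv_eq
    have h2z : (2 * z) • L (G (L v)) = (1 + z ^ 2) • L v := by
      linear_combination (norm := module) -hLv_eq
    have h2 : (2 : 𝕜) ≠ 0 := two_ne_zero
    rw [← inv_smul_smul₀ (mul_ne_zero h2 hz0) (L (G (L v))), h2z, smul_smul]
    congr 1
    field_simp
    ring

theorem reflectionWalk_eq_self_iff [NeZero (2 : 𝕜)] (h : IsReflectionPair L G A)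
    (hfix : ∀ a ∈ A, L (G a) = a → G a = a) (hv : v ∈ A ⊔ A.map G) :
    reflectionWalk L G v = v ↔ v ∈ A ∧ L (G v) = v := by
  constructor
  · intro hU
    have hGv : G v = (2 : 𝕜) • L v - v := by
      simpa only [one_smul] using
        h.invol_apply_of_reflectionWalk_eq_smul hv (hU.trans (one_smul 𝕜 v).symm)
    obtain ⟨a, ha, b, hb, hab⟩ := exists_eq_add hv
    have hsub : v - G v = (a - b) - G (a - b) := by
      rw [hab, map_add, map_sub, h.invol_invol b hb]
      abel
    have hLsub : L (v - G v) = 0 := by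
      rw [hGv, map_sub, map_sub, map_smul, h.proj_apply _ (h.proj_mem hv)]
      module
    have hGfix : G (a - b) = a - b := by
      have hc := A.sub_mem ha hb
      refine hfix _ hc (Eq.symm (sub_eq_zero.mp ?_))
      rw [← hLsub, hsub, map_sub L (a - b), h.proj_apply _ hc]
    have hGv_self : G v = v := by
      rw [hGfix, sub_self] at hsub
      exact (sub_eq_zero.mp hsub).symm
    have hLv : L v = v := by
      refine smul_right_injective E (two_ne_zero (α := 𝕜)) ?_
      linear_combination (norm := module) hGv_self - hGv
    exact ⟨hLv ▸ h.proj_mem hv, by rw [hGv_self, hLv]⟩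
  · rintro ⟨hvA, hLGv⟩
    rw [reflectionWalk_apply, hLGv, hfix v hvA hLGv]
    module

end IsReflectionPair

end ReflectionPair

section Matrix

variable {R n : Type*} [CommRing R] [StarRing R] [Fintype n]

theorem conjTranspose_mulVec_apply [DecidableEq n] {m : Type*} [Fintype m] (M : Matrix m n R)
    (w : m → R) (i : n) : (Mᴴ *ᵥ w) i = star (M *ᵥ Pi.single i 1) ⬝ᵥ w := by
  rw [Matrix.mulVec_single_one]
  rfl

theorem conjTranspose_mulVec_mulVec [DecidableEq n] {M : Matrix n n R}
    (hM : M ∈ Matrix.unitaryGroup n R) (v : n → R) : Mᴴ *ᵥ (M *ᵥ v) = v := by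
  rw [Matrix.mulVec_mulVec, ← Matrix.star_eq_conjTranspose, Matrix.mem_unitaryGroup_iff'.mp hM,
    Matrix.one_mulVec]

theorem mulVec_conjTranspose_mulVec [DecidableEq n] {M : Matrix n n R}
    (hM : M ∈ Matrix.unitaryGroup n R) (v : n → R) : M *ᵥ (Mᴴ *ᵥ v) = v := by
  rw [Matrix.mulVec_mulVec, ← Matrix.star_eq_conjTranspose, Matrix.mem_unitaryGroup_iff.mp hM,
    Matrix.one_mulVec]

theorem mulVec_eq_self_of_isStarProjection [PartialOrder R] [StarOrderedRing R] [NoZeroDivisors R]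
    [DecidableEq n] {G L : Matrix n n R} (hG : G ∈ Matrix.unitaryGroup n R)
    (hL : IsStarProjection L) {v : n → R} (h : L *ᵥ (G *ᵥ v) = v) : G *ᵥ v = v := by
  have adjoint (M : Matrix n n R) (x y : n → R) : star (M *ᵥ x) ⬝ᵥ y = star x ⬝ᵥ (Mᴴ *ᵥ y) := by
    rw [Matrix.star_mulVec, Matrix.dotProduct_mulVec]
  have hLv : L *ᵥ v = v := by
    rw [← h, Matrix.mulVec_mulVec, hL.isIdempotentElem.eq]
  have hLL : Lᴴ = L := hL.isSelfAdjoint.star_eq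
  have hGG : star (G *ᵥ v) ⬝ᵥ (G *ᵥ v) = star v ⬝ᵥ v := by
    rw [adjoint, conjTranspose_mulVec_mulVec hG]
  have hvG : star v ⬝ᵥ (G *ᵥ v) = star v ⬝ᵥ v := by
    nth_rw 1 [← hLv]
    rw [adjoint, hLL, h]
  have hGv : star (G *ᵥ v) ⬝ᵥ v = star v ⬝ᵥ v := by
    nth_rw 2 [← hLv]
    rw [← hLL, ← adjoint, h]
  refine sub_eq_zero.mp (dotProduct_star_self_eq_zero.mp ?_)
  rw [star_sub, sub_dotProduct, dotProduct_sub, dotProduct_sub, hGG, hvG, hGv]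
  ring

theorem mem_spectrum_of_mulVec_eq_smul {K : Type*} [Field K] [DecidableEq n] {M : Matrix n n K}
    {v : n → K} (hv : v ≠ 0) {z : K} (h : M *ᵥ v = z • v) : z ∈ spectrum K M := by
  rw [← Matrix.spectrum_toLin']
  exact (Module.End.hasEigenvalue_of_hasEigenvector
    (Module.End.hasEigenvector_iff.mpr ⟨Module.End.mem_eigenspace_iff.mpr h, hv⟩)).mem_spectrum

open scoped Matrix.Norms.L2Operator in
theorem norm_eq_one_of_mulVec_eq_smul {𝕜 : Type*} [RCLike 𝕜] [DecidableEq n] {M : Matrix n n 𝕜}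
    (hM : M ∈ Matrix.unitaryGroup n 𝕜) {v : n → 𝕜} (hv : v ≠ 0) {z : 𝕜} (h : M *ᵥ v = z • v) :
    ‖z‖ = 1 :=
  mem_sphere_zero_iff_norm.mp
    (spectrum.subset_circle_of_unitary hM (mem_spectrum_of_mulVec_eq_smul hv h))

theorem apply_map_algebraMap_mulVec {S A : Type*} [CommSemiring S] [Semiring A] [Algebra S A]
    (f : A →ₗ[S] S) (M : Matrix n n S) (h : n → A) :
    f ∘ (M.map (algebraMap S A) *ᵥ h) = M *ᵥ (f ∘ h) := by
  ext i
  simp only [Function.comp_apply, Matrix.mulVec, dotProduct, Matrix.map_apply, map_sum,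
    ← Algebra.smul_def, map_smul, smul_eq_mul]

theorem kronecker_mulVec_mul {S l m p : Type*} [CommSemiring S] [Fintype m] (M : Matrix l m S)
    (N : Matrix p n S) (u : m → S) (w : n → S) :
    (M ⊗ₖ N) *ᵥ (fun i => u i.1 * w i.2) = fun i => (M *ᵥ u) i.1 * (N *ᵥ w) i.2 := by
  ext ⟨i, j⟩
  simp only [Matrix.mulVec, dotProduct, Fintype.sum_prod_type, Matrix.kronecker_apply,
    Finset.sum_mul_sum, mul_mul_mul_comm]

end Matrix

theorem mapsTo_of_leftInverse {K E : Type*} [Field K] [AddCommGroup E] [Module K E]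
    {A : Submodule K E} [FiniteDimensional K A] {f g : E →ₗ[K] E} (hgf : Function.LeftInverse g f)
    (hf : Set.MapsTo f A A) : Set.MapsTo g A A := by
  have hinj : Function.Injective (f.restrict hf) := fun x y hxy =>
    Subtype.ext (hgf.injective (congrArg Subtype.val hxy))
  intro v hv
  obtain ⟨w, hw⟩ := LinearMap.injective_iff_surjective.mp hinj ⟨v, hv⟩
  rw [← show f w = v from congrArg Subtype.val hw, hgf]
  exact w.2

theorem le_getD_one_sort {α : Type*} [LinearOrder α] {s : Multiset α} {a b : α} (hba : b ≤ a)
    (h : {a, b} ≤ s) (d : α) : b ≤ (s.sort (· ≥ ·)).getD 1 d := by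
  have hsort : (s.sort (· ≥ ·)).Pairwise (· ≥ ·) := s.pairwise_sort _
  have hsub : [a, b].Sublist (s.sort (· ≥ ·)) := by
    refine List.sublist_of_subperm_of_pairwise ?_ (by simpa using hba) hsort
    rw [← Multiset.coe_le, Multiset.sort_eq]
    exact h
  generalize s.sort (· ≥ ·) = l at hsub hsort
  match l, hsort, hsub with
  | [], _, hsub => exact absurd hsub (by simp)
  | c :: t, hsort, hsub =>
    have hb : b ∈ t := by
      cases hsub with
      | cons _ hsub => exact hsub.subset (by simp)
      | cons_cons _ hsub => exact hsub.subset (by simp)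
    obtain ⟨e, t, rfl⟩ := List.exists_cons_of_ne_nil (List.ne_nil_of_mem hb)
    rcases List.mem_cons.mp hb with rfl | hb
    · exact le_rfl
    · exact List.rel_of_pairwise_cons hsort.of_cons hb

theorem arccos_le_abs_of_cos_le {θ c : ℝ} (h : Real.cos θ ≤ c) : Real.arccos c ≤ |θ| := by
  rcases le_total |θ| Real.pi with hθ | hθ
  · calc Real.arccos c ≤ Real.arccos (Real.cos |θ|) :=
          Real.arccos_le_arccos ((Real.cos_abs θ).trans_le h)
      _ = |θ| := Real.arccos_cos (abs_nonneg θ) hθ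
  · exact (Real.arccos_le_pi c).trans hθ

theorem eq_one_of_half_add_inv_eq_one {K : Type*} [Field K] [NeZero (2 : K)] {z : K}
    (h : (z + z⁻¹) / 2 = 1) : z = 1 := by
  have hz0 : z ≠ 0 := by
    rintro rfl
    simp at h
  have h2 : (2 : K) ≠ 0 := two_ne_zero
  field_simp at h
  have hsq : (z - 1) ^ 2 = 0 := by linear_combination h
  exact sub_eq_zero.mp (pow_eq_zero_iff two_ne_zero |>.mp hsq)

theorem apply_eq_apply_of_mulVec_eq_self {n R : Type*} [Fintype n] [Ring R] [LinearOrder R]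
    [IsStrictOrderedRing R] {W : Matrix n n R} (hpos : ∀ x y, x ≠ y → 0 < W x y)
    (hsum : W *ᵥ 1 = 1) {h : n → R} (hh : W *ᵥ h = h) (x y : n) : h x = h y := by
  classical
  have : Nonempty n := ⟨x⟩
  obtain ⟨x₀, hx₀⟩ := Finite.exists_max h
  have hterm : ∀ y ∈ Finset.univ, 0 ≤ W x₀ y * (h x₀ - h y) := by
    intro y _
    obtain rfl | hy := eq_or_ne x₀ y
    · rw [sub_self, mul_zero]
    · exact mul_nonneg (hpos x₀ y hy).le (sub_nonneg.mpr (hx₀ y))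
  have hdefect : ∑ y, W x₀ y * (h x₀ - h y) = 0 := by
    have h1 := congrFun hsum x₀
    have h2 := congrFun hh x₀
    simp only [Matrix.mulVec, dotProduct, Pi.one_apply, mul_one] at h1 h2
    simp only [mul_sub, Finset.sum_sub_distrib, ← Finset.sum_mul, h1, h2, one_mul, sub_self]
  have hmax (z : n) : h z = h x₀ := by
    obtain rfl | hz := eq_or_ne x₀ z
    · rfl
    · have h0 := (Finset.sum_eq_zero_iff_of_nonneg hterm).mp hdefect z (Finset.mem_univ z)
      exact (sub_eq_zero.mp ((mul_eq_zero.mp h0).resolve_left (hpos x₀ z hz).ne')).symm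
  rw [hmax x, hmax y]

namespace MHChain

variable {d : ℕ} {C : MHChain d}

theorem sub_mem_moves (x : Fin d → ℝ) {y : Fin d → ℝ} (hy : y ∈ C.Ω) : y - x ∈ C.moves x :=
  Finset.mem_image_of_mem _ hy

theorem ofReal_sqrt_P_ne_zero {x : Fin d → ℝ} (hx : x ∈ C.Ω) : ((√(C.P x) : ℝ) : ℂ) ≠ 0 :=
  Complex.ofReal_ne_zero.mpr (Real.sqrt_ne_zero'.mpr (C.P_mem x hx).1)

theorem acc_le_one (x y : Fin d → ℝ) : C.acc x y ≤ 1 := min_le_left _ _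

theorem acc_pos {x y : Fin d → ℝ} (hx : x ∈ C.Ω) (hy : y ∈ C.Ω) : 0 < C.acc x y :=
  lt_min one_pos (div_pos (mul_pos (C.P_mem y hy).1 (C.T_mem y hy x hx).1)
    (mul_pos (C.P_mem x hx).1 (C.T_mem x hx y hy).1))

theorem T_mul_acc_pos {x y : Fin d → ℝ} (hx : x ∈ C.Ω) (hy : y ∈ C.Ω) :
    0 < C.T x y * C.acc x y :=
  mul_pos (C.T_mem x hx y hy).1 (acc_pos hx hy)

theorem P_mul_T_mul_acc {x y : Fin d → ℝ} (hx : x ∈ C.Ω) (hy : y ∈ C.Ω) :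
    C.P x * (C.T x y * C.acc x y) = min (C.P x * C.T x y) (C.P y * C.T y x) := by
  have hpos : 0 < C.P x * C.T x y := mul_pos (C.P_mem x hx).1 (C.T_mem x hx y hy).1
  rw [acc, ← mul_assoc, mul_min_of_nonneg _ _ hpos.le, mul_one, mul_div_cancel₀ _ hpos.ne']

theorem detailed_balance {x y : Fin d → ℝ} (hx : x ∈ C.Ω) (hy : y ∈ C.Ω) :
    C.P x * (C.T x y * C.acc x y) = C.P y * (C.T y x * C.acc y x) := by
  rw [P_mul_T_mul_acc hx hy, P_mul_T_mul_acc hy hx, min_comm]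

variable (C)

/-- The probability that a proposal made in the state `x` is rejected. -/
noncomputable def rejection (x : Fin d → ℝ) : ℝ := ∑ y ∈ C.Ω, C.T x y * (1 - C.acc x y)

theorem W_apply (x y : C.Ω) :
    C.W x y = (if x = y then C.rejection x else 0) + C.T x y * C.acc x y := by
  rw [W, Matrix.of_apply]
  split_ifs with hxy
  · subst hxy
    simp only [rejection, mul_sub, mul_one, Finset.sum_sub_distrib, C.T_sum x x.2,
      Finset.sum_erase_eq_sub x.2]
    ring
  · rw [zero_add]

theorem W_pos {x y : C.Ω} (hxy : x ≠ y) : 0 < C.W x y := by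
  rw [W_apply, if_neg hxy, zero_add]
  exact T_mul_acc_pos x.2 y.2

theorem W_mulVec_one : C.W *ᵥ 1 = 1 := by
  ext x
  simp only [Matrix.mulVec, dotProduct, W_apply, Pi.one_apply, mul_one, Finset.sum_add_distrib,
    Finset.sum_ite_eq, Finset.mem_univ, if_true]
  rw [Finset.sum_coe_sort C.Ω fun y => C.T x y * C.acc x y, rejection, ← Finset.sum_add_distrib]
  refine Eq.trans ?_ (C.T_sum x x.2)
  exact Finset.sum_congr rfl fun y _ => by ring

/-- The transition matrix over `ℂ`, acting on functions `C.Ω → ℂ`. -/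
noncomputable def complexW : Matrix C.Ω C.Ω ℂ := C.W.map (algebraMap ℝ ℂ)

theorem complexW_mulVec_one : C.complexW *ᵥ 1 = 1 := by
  ext x
  have h := RingHom.map_mulVec (algebraMap ℝ ℂ) C.W 1 x
  rw [W_mulVec_one] at h
  simpa [complexW, Function.comp_def, Pi.one_def] using h.symm

instance : Nonempty C.Ω :=
  (Finset.nonempty_of_sum_ne_zero (C.P_sum.trans_ne one_ne_zero)).to_subtype

theorem complexW_mulVec_eq_self_iff {h : C.Ω → ℂ} :
    C.complexW *ᵥ h = h ↔ ∃ c : ℂ, h = c • 1 := by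
  constructor
  · intro hh
    have hconst (f : ℂ →ₗ[ℝ] ℝ) (x y : C.Ω) : f (h x) = f (h y) :=
      apply_eq_apply_of_mulVec_eq_self (fun _ _ => C.W_pos) C.W_mulVec_one
        (by rw [← apply_map_algebraMap_mulVec, ← complexW, hh] : C.W *ᵥ (f ∘ h) = f ∘ h) x y
    obtain ⟨x₀⟩ := (inferInstance : Nonempty C.Ω)
    refine ⟨h x₀, funext fun x => ?_⟩
    rw [Pi.smul_apply, Pi.one_apply, smul_eq_mul, mul_one]
    exact Complex.ext (hconst Complex.reLm x x₀) (hconst Complex.imLm x x₀)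
  · rintro ⟨c, rfl⟩
    rw [Matrix.mulVec_smul, complexW_mulVec_one]

theorem norm_le_one_sub_spectralGap {h : C.Ω → ℂ} (hh : h ≠ 0) {z : ℂ} (hz : z ≠ 1)
    (hz_le : ‖z‖ ≤ 1) (hWh : C.complexW *ᵥ h = z • h) : ‖z‖ ≤ 1 - C.spectralGap := by
  have hroot {g : C.Ω → ℂ} (hg : g ≠ 0) {w : ℂ} (hWg : C.complexW *ᵥ g = w • g) :
      w ∈ C.complexW.charpoly.roots :=
    (Polynomial.mem_roots (Matrix.charpoly_monic _).ne_zero).mpr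
      (Matrix.mem_spectrum_iff_isRoot_charpoly.mp (mem_spectrum_of_mulVec_eq_smul hg hWg))
  have hroots : {1, z} ≤ C.complexW.charpoly.roots := by
    refine (Multiset.le_iff_subset (by simpa using hz.symm)).mpr fun w hw => ?_
    rcases Multiset.mem_cons.mp hw with rfl | hw
    · exact hroot one_ne_zero (by rw [complexW_mulVec_one, one_smul])
    · exact Multiset.mem_singleton.mp hw ▸ hroot hh hWh
  have hmoduli : {1, ‖z‖} ≤ C.complexW.charpoly.roots.map fun w => ‖w‖ := by
    simpa using Multiset.map_le_map (f := fun w : ℂ => ‖w‖) hroots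
  rw [spectralGap, sub_sub_cancel]
  exact le_getD_one_sort hz_le hmoduli 0

/-- The symmetric discriminant of the chain. It is conjugate to `W` by the diagonal matrix with
entries `√P`. -/
noncomputable def discriminant : Matrix C.Ω C.Ω ℝ := Matrix.of fun x y =>
  (if x = y then C.rejection x else 0) + √(C.T x y * C.acc x y) * √(C.T y x * C.acc y x)

theorem sqrt_P_mul_discriminant (x y : C.Ω) :
    √(C.P y) * C.discriminant x y = √(C.P x) * C.W x y := by
  have hbalance : √(C.P y) * √(C.T y x * C.acc y x) = √(C.P x) * √(C.T x y * C.acc x y) := by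
    rw [← Real.sqrt_mul (C.P_mem y y.2).1.le, ← Real.sqrt_mul (C.P_mem x x.2).1.le,
      detailed_balance x.2 y.2]
  rw [discriminant, Matrix.of_apply, W_apply, mul_add, mul_add, mul_left_comm, hbalance,
    mul_left_comm, Real.mul_self_sqrt (T_mul_acc_pos x.2 y.2).le]
  split_ifs with hxy
  · rw [hxy]
  · rw [mul_zero, mul_zero]

end MHChain

namespace WalkCircuit

variable {d : ℕ} {C : MHChain d} (Q : WalkCircuit C)

/-- The label of the basis state `|x⟩|y - x⟩|c⟩`, which represents the proposal to move from `x`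
to `y`. -/
def proposalIdx (x y : C.Ω) (c : Fin 2) : Q.Idx :=
  (⟨x, Q.states_subset x.2⟩,
    ⟨y - x, Q.moves_subset x x.2 (MHChain.sub_mem_moves x y.2)⟩, c)

/-- The basis state `|x⟩|y - x⟩|c⟩`. -/
noncomputable def proposalKet (x y : C.Ω) (c : Fin 2) : Q.Idx → ℂ :=
  Pi.single (Q.proposalIdx x y c) 1

/-- The label of the basis state `|x⟩|0⟩|0⟩`, which represents the state `x` of the chain. -/
def stateIdx (x : C.Ω) : Q.Idx := Q.proposalIdx x x 0

/-- The basis state `|x⟩|0⟩|0⟩`. -/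
noncomputable def stateKet (x : C.Ω) : Q.Idx → ℂ := Pi.single (Q.stateIdx x) 1

theorem proposalIdx_inj {x y x' y' : C.Ω} {c c' : Fin 2} :
    Q.proposalIdx x y c = Q.proposalIdx x' y' c' ↔ x = x' ∧ y = y' ∧ c = c' := by
  simp only [proposalIdx, Prod.mk.injEq, Subtype.mk.injEq, SetLike.coe_eq_coe]
  refine and_congr_right ?_
  rintro rfl
  rw [sub_left_inj, SetLike.coe_eq_coe]

theorem stateIdx_inj {x y : C.Ω} : Q.stateIdx x = Q.stateIdx y ↔ x = y := by
  rw [stateIdx, stateIdx, proposalIdx_inj]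
  tauto

theorem ket₃_eq_single (i : Q.Idx) : ket₃ i.1 i.2.1 i.2.2 = (Pi.single i 1 : Q.Idx → ℂ) := by
  ext j
  simp only [ket₃, Pi.single_apply, Prod.ext_iff, Subtype.ext_iff]

theorem ket₃_sub (x y : C.Ω) (c : Fin 2) :
    ket₃ (x : Fin d → ℝ) (y - x) c = Q.proposalKet x y c :=
  Q.ket₃_eq_single (Q.proposalIdx x y c)

theorem ket₃_zero (x : C.Ω) : ket₃ (x : Fin d → ℝ) 0 0 = Q.stateKet x := by
  rw [← sub_self (x : Fin d → ℝ)]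
  exact Q.ket₃_sub x x 0

theorem spaceA_eq_span : Q.spaceA = Submodule.span ℂ (Set.range Q.stateKet) := by
  rw [spaceA]
  congr 1
  ext v
  simp only [Set.mem_ofPred_eq, Set.mem_range, Subtype.exists, ← ket₃_zero, exists_prop,
    eq_comm]

theorem opV_mulVec_mul (u : Q.SReg × Q.MReg → ℂ) (w : Fin 2 → ℂ) :
    Q.opV *ᵥ (fun i => u (i.1, i.2.1) * w i.2.2) =
      fun i => ((Q.V : Matrix (Q.SReg × Q.MReg) (Q.SReg × Q.MReg) ℂ) *ᵥ u) (i.1, i.2.1) *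
        w i.2.2 := by
  rw [opV, Matrix.reindex_apply, Matrix.submatrix_mulVec_equiv]
  have h := kronecker_mulVec_mul
    (Q.V : Matrix (Q.SReg × Q.MReg) (Q.SReg × Q.MReg) ℂ) (1 : Matrix (Fin 2) (Fin 2) ℂ) u w
  rw [Matrix.one_mulVec] at h
  exact congrArg (· ∘ (Equiv.prodAssoc _ _ _).symm) h

theorem opV_mulVec_stateKet (x : C.Ω) :
    Q.opV *ᵥ Q.stateKet x = ∑ y : C.Ω, ((√(C.T x y) : ℝ) : ℂ) • Q.proposalKet x y 0 := by
  have hket (m : Fin d → ℝ) : (ket₃ (x : Fin d → ℝ) m 0 : Q.Idx → ℂ) =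
      fun i => ket₂ (x : Fin d → ℝ) m (i.1, i.2.1) * (Pi.single 0 1 : Fin 2 → ℂ) i.2.2 := by
    ext i
    simp only [ket₃, ket₂, Pi.single_apply, ite_and, ite_mul, one_mul, zero_mul]
  have hsum : ∑ y : C.Ω, ((√(C.T x y) : ℝ) : ℂ) • Q.proposalKet x y 0 =
      ∑ m ∈ C.moves x, ((√(C.T x (x + m)) : ℝ) : ℂ) • ket₃ (x : Fin d → ℝ) m 0 := by
    rw [MHChain.moves, Finset.sum_image sub_left_injective.injOn]
    simp only [add_sub_cancel, ← ket₃_sub]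
    exact Finset.sum_coe_sort C.Ω fun y => ((√(C.T x y) : ℝ) : ℂ) • ket₃ (x : Fin d → ℝ) (y - x) 0
  rw [hsum, ← ket₃_zero, hket, opV_mulVec_mul, Q.V_apply x x.2]
  ext i
  simp only [hket, Finset.sum_apply, Pi.smul_apply, Finset.sum_mul, smul_eq_mul, mul_assoc]

theorem opS_mulVec_ket₃ {m m' : Fin d → ℝ} {c c' : Fin 2} (x : Fin d → ℝ)
    (h : (Q.S : Matrix (Q.MReg × Fin 2) (Q.MReg × Fin 2) ℂ) *ᵥ ketQ m c = ketQ m' c') :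
    Q.opS *ᵥ ket₃ x m c = ket₃ x m' c' := by
  have hket (m : Fin d → ℝ) (c : Fin 2) : (ket₃ x m c : Q.Idx → ℂ) =
      fun i => (if (i.1 : Fin d → ℝ) = x then 1 else 0) * ketQ m c i.2 := by
    ext i
    simp only [ket₃, ketQ, ite_and, ite_mul, one_mul, zero_mul]
  rw [hket, opS, kronecker_mulVec_mul _ _ fun s : Q.SReg => if (s : Fin d → ℝ) = x then 1 else 0, h,
    Matrix.one_mulVec, ← hket]

theorem opB_mulVec_proposalKet_zero (x y : C.Ω) :
    Q.opB *ᵥ Q.proposalKet x y 0 =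
      ((√(1 - C.acc x y) : ℝ) : ℂ) • Q.proposalKet x y 0 +
        ((√(C.acc x y) : ℝ) : ℂ) • Q.proposalKet x y 1 := by
  have h := Q.B_apply_zero x x.2 (y - x) (MHChain.sub_mem_moves x y.2)
  rwa [add_sub_cancel, ket₃_sub, ket₃_sub] at h

theorem opB_mulVec_proposalKet_one (x y : C.Ω) :
    Q.opB *ᵥ Q.proposalKet x y 1 =
      (-((√(C.acc x y) : ℝ) : ℂ)) • Q.proposalKet x y 0 +
        ((√(1 - C.acc x y) : ℝ) : ℂ) • Q.proposalKet x y 1 := by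
  have h := Q.B_apply_one x x.2 (y - x) (MHChain.sub_mem_moves x y.2)
  rwa [add_sub_cancel, ket₃_sub, ket₃_sub] at h

/-- The operator `B V`, which attaches the proposals and the outcome of the acceptance test to a
state of the chain. -/
def prepare : Matrix Q.Idx Q.Idx ℂ := Q.opB * Q.opV

/-- The operator `S F`, which exchanges the two ends of an accepted proposal. -/
noncomputable def swap : Matrix Q.Idx Q.Idx ℂ := Q.opS * Q.opF

theorem core_eq : Q.core = Q.prepareᴴ * Q.swap * Q.prepare := by
  simp only [core, prepare, swap, Matrix.conjTranspose_mul, Matrix.mul_assoc]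

theorem prepare_mulVec_stateKet (x : C.Ω) :
    Q.prepare *ᵥ Q.stateKet x = ∑ y : C.Ω, ((√(C.T x y) : ℝ) : ℂ) •
      (((√(1 - C.acc x y) : ℝ) : ℂ) • Q.proposalKet x y 0 +
        ((√(C.acc x y) : ℝ) : ℂ) • Q.proposalKet x y 1) := by
  rw [prepare, ← Matrix.mulVec_mulVec, opV_mulVec_stateKet, Matrix.mulVec_sum]
  simp only [Matrix.mulVec_smul, opB_mulVec_proposalKet_zero]

theorem swap_mulVec_proposalKet_zero (x y : C.Ω) :
    Q.swap *ᵥ Q.proposalKet x y 0 = Q.proposalKet x y 0 := by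
  have hm := MHChain.sub_mem_moves x y.2
  rw [swap, ← Matrix.mulVec_mulVec, ← ket₃_sub, opF, Q.F_apply_zero x x.2 _ hm,
    Q.opS_mulVec_ket₃ x (Q.S_apply_zero x x.2 _ hm)]

theorem swap_mulVec_proposalKet_one (x y : C.Ω) :
    Q.swap *ᵥ Q.proposalKet x y 1 = Q.proposalKet y x 1 := by
  have hm := MHChain.sub_mem_moves x y.2
  rw [swap, ← Matrix.mulVec_mulVec, ← ket₃_sub, opF, Q.F_apply_one x x.2 _ hm, add_sub_cancel,
    Q.opS_mulVec_ket₃ y (Q.S_apply_one x x.2 _ hm), neg_sub, ket₃_sub]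

theorem opV_mem_unitaryGroup : Q.opV ∈ Matrix.unitaryGroup Q.Idx ℂ := by
  have h := Matrix.kronecker_mem_unitary Q.V.2 (one_mem (Matrix.unitaryGroup (Fin 2) ℂ))
  rw [Matrix.mem_unitaryGroup_iff, Matrix.star_eq_conjTranspose] at h ⊢
  rw [opV, Matrix.conjTranspose_reindex, Matrix.reindex_apply, Matrix.reindex_apply,
    Matrix.submatrix_mul_equiv, h, Matrix.submatrix_one_equiv]

theorem prepare_mem_unitaryGroup : Q.prepare ∈ Matrix.unitaryGroup Q.Idx ℂ :=
  mul_mem Q.B.2 Q.opV_mem_unitaryGroup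

theorem swap_mem_unitaryGroup : Q.swap ∈ Matrix.unitaryGroup Q.Idx ℂ :=
  mul_mem (Matrix.kronecker_mem_unitary (one_mem _) Q.S.2) Q.F.2

theorem core_mem_unitaryGroup : Q.core ∈ Matrix.unitaryGroup Q.Idx ℂ :=
  Q.core_eq ▸ mul_mem (mul_mem (Unitary.star_mem Q.prepare_mem_unitaryGroup)
    Q.swap_mem_unitaryGroup) Q.prepare_mem_unitaryGroup

theorem isStarProjection_proj₀ : IsStarProjection Q.proj₀ where
  isIdempotentElem := by
    simp only [IsIdempotentElem, proj₀, Matrix.diagonal_mul_diagonal]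
    congr 1
    ext i
    split_ifs
    · rw [mul_one]
    · rw [mul_zero]
  isSelfAdjoint := by
    simp only [IsSelfAdjoint, proj₀, Matrix.star_eq_conjTranspose,
      Matrix.diagonal_conjTranspose]
    congr 1
    ext i
    simp only [Pi.star_apply, apply_ite star, star_one, star_zero]

theorem opR_mem_unitaryGroup : Q.opR ∈ Matrix.unitaryGroup Q.Idx ℂ := by
  rw [opR, two_smul, ← two_mul]
  exact Q.isStarProjection_proj₀.two_mul_sub_one_mem_unitary

theorem U_mem_unitaryGroup : Q.U ∈ Matrix.unitaryGroup Q.Idx ℂ :=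
  mul_mem Q.opR_mem_unitaryGroup Q.core_mem_unitaryGroup

/-- The span of the basis states that represent a proposal. -/
def proposalSpace : Submodule ℂ (Q.Idx → ℂ) :=
  Submodule.span ℂ {v | ∃ x y c, v = Q.proposalKet x y c}

theorem proposalKet_mem (x y : C.Ω) (c : Fin 2) : Q.proposalKet x y c ∈ Q.proposalSpace :=
  Submodule.subset_span ⟨x, y, c, rfl⟩

theorem opB_mulVec_mem_proposalSpace :
    Set.MapsTo Q.opB.mulVecLin Q.proposalSpace Q.proposalSpace := by
  refine Submodule.span_le (p := Q.proposalSpace.comap Q.opB.mulVecLin).mpr ?_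
  rintro _ ⟨x, y, c, rfl⟩
  have hmem (a b : ℂ) : a • Q.proposalKet x y 0 + b • Q.proposalKet x y 1 ∈ Q.proposalSpace :=
    add_mem (Submodule.smul_mem _ _ (Q.proposalKet_mem x y 0))
      (Submodule.smul_mem _ _ (Q.proposalKet_mem x y 1))
  rw [SetLike.mem_coe, Submodule.mem_comap, Matrix.mulVecLin_apply]
  match c with
  | 0 => exact (Q.opB_mulVec_proposalKet_zero x y).symm ▸ hmem _ _
  | 1 => exact (Q.opB_mulVec_proposalKet_one x y).symm ▸ hmem _ _

theorem prepare_mulVec_mem_proposalSpace {v : Q.Idx → ℂ} (hv : v ∈ Q.spaceA) :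
    Q.prepare *ᵥ v ∈ Q.proposalSpace := by
  suffices Q.spaceA ≤ Q.proposalSpace.comap Q.prepare.mulVecLin from this hv
  rw [spaceA_eq_span, Submodule.span_le]
  rintro _ ⟨x, rfl⟩
  rw [SetLike.mem_coe, Submodule.mem_comap, Matrix.mulVecLin_apply, prepare_mulVec_stateKet]
  exact sum_mem fun y _ => Submodule.smul_mem _ _ (add_mem
    (Submodule.smul_mem _ _ (Q.proposalKet_mem x y 0))
    (Submodule.smul_mem _ _ (Q.proposalKet_mem x y 1)))

theorem swap_mulVec_mem_proposalSpace {v : Q.Idx → ℂ} (hv : v ∈ Q.proposalSpace) :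
    Q.swap *ᵥ v ∈ Q.proposalSpace := by
  suffices Q.proposalSpace ≤ Q.proposalSpace.comap Q.swap.mulVecLin from this hv
  refine Submodule.span_le.mpr ?_
  rintro _ ⟨x, y, c, rfl⟩
  rw [SetLike.mem_coe, Submodule.mem_comap, Matrix.mulVecLin_apply]
  match c with
  | 0 => exact (Q.swap_mulVec_proposalKet_zero x y).symm ▸ Q.proposalKet_mem x y 0
  | 1 => exact (Q.swap_mulVec_proposalKet_one x y).symm ▸ Q.proposalKet_mem y x 1

theorem swap_mulVec_swap_mulVec {v : Q.Idx → ℂ} (hv : v ∈ Q.proposalSpace) :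
    Q.swap *ᵥ (Q.swap *ᵥ v) = v := by
  refine LinearMap.eqOn_span (f := Q.swap.mulVecLin ∘ₗ Q.swap.mulVecLin) (g := LinearMap.id) ?_ hv
  rintro _ ⟨x, y, c, rfl⟩
  match c with
  | 0 => simp [swap_mulVec_proposalKet_zero]
  | 1 => simp [swap_mulVec_proposalKet_one]

theorem core_mulVec_core_mulVec {v : Q.Idx → ℂ} (hv : v ∈ Q.spaceA) :
    Q.core *ᵥ (Q.core *ᵥ v) = v := by
  simp only [core_eq, ← Matrix.mulVec_mulVec]
  rw [mulVec_conjTranspose_mulVec Q.prepare_mem_unitaryGroup,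
    Q.swap_mulVec_swap_mulVec (Q.prepare_mulVec_mem_proposalSpace hv),
    conjTranspose_mulVec_mulVec Q.prepare_mem_unitaryGroup]

/-- The span of the basis states whose label on `R_S` is a state of the chain. -/
def stateSpace : Submodule ℂ (Q.Idx → ℂ) :=
  Submodule.pi {i | (i.1 : Fin d → ℝ) ∉ C.Ω} fun _ => ⊥

theorem mem_stateSpace {v : Q.Idx → ℂ} :
    v ∈ Q.stateSpace ↔ ∀ i : Q.Idx, (i.1 : Fin d → ℝ) ∉ C.Ω → v i = 0 := by
  simp only [stateSpace, Submodule.mem_pi, Set.mem_ofPred_eq, Submodule.mem_bot]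

theorem proposalSpace_le_stateSpace : Q.proposalSpace ≤ Q.stateSpace := by
  refine Submodule.span_le.mpr ?_
  rintro _ ⟨x, y, c, rfl⟩
  refine Q.mem_stateSpace.mpr fun i hi => Pi.single_eq_of_ne ?_ 1
  rintro rfl
  exact hi x.2

theorem opV_mulVec_mem_stateSpace : Set.MapsTo Q.opV.mulVecLin Q.stateSpace Q.stateSpace := by
  intro v hv
  refine Q.mem_stateSpace.mpr fun i hi => ?_
  rw [Matrix.mulVecLin_apply, Matrix.mulVec, dotProduct]
  refine Finset.sum_eq_zero fun j _ => ?_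
  by_cases hj : (j.1 : Fin d → ℝ) ∈ C.Ω
  · have hV : Q.opV i j = 0 := by
      rw [opV, Matrix.reindex_apply, Matrix.submatrix_apply, Matrix.kronecker_apply,
        Q.V_states _ _ hj hi, zero_mul]
    rw [hV, zero_mul]
  · rw [Q.mem_stateSpace.mp hv j hj, mul_zero]

theorem core_mulVec_mem_stateSpace {v : Q.Idx → ℂ} (hv : v ∈ Q.spaceA) :
    Q.core *ᵥ v ∈ Q.stateSpace := by
  have hB : Set.MapsTo Q.opBᴴ.mulVecLin Q.proposalSpace Q.proposalSpace :=
    mapsTo_of_leftInverse (f := Q.opB.mulVecLin) (conjTranspose_mulVec_mulVec Q.B.2)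
      Q.opB_mulVec_mem_proposalSpace
  have hV : Set.MapsTo Q.opVᴴ.mulVecLin Q.stateSpace Q.stateSpace :=
    mapsTo_of_leftInverse (f := Q.opV.mulVecLin)
      (conjTranspose_mulVec_mulVec Q.opV_mem_unitaryGroup)
      Q.opV_mulVec_mem_stateSpace
  rw [core_eq, prepare, Matrix.conjTranspose_mul]
  simp only [← Matrix.mulVec_mulVec]
  exact hV (Q.proposalSpace_le_stateSpace (hB (Q.swap_mulVec_mem_proposalSpace
    (Matrix.mulVec_mulVec v Q.opB Q.opV ▸ Q.prepare_mulVec_mem_proposalSpace hv))))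

theorem exists_eq_stateIdx {i : Q.Idx} (hx : (i.1 : Fin d → ℝ) ∈ C.Ω)
    (h0 : (i.2.1 : Fin d → ℝ) = 0 ∧ i.2.2 = 0) : ∃ x, i = Q.stateIdx x := by
  obtain ⟨⟨x, _⟩, ⟨m, _⟩, c⟩ := i
  obtain ⟨rfl, rfl⟩ := h0
  refine ⟨⟨x, hx⟩, ?_⟩
  simp only [stateIdx, proposalIdx, sub_self]

theorem proj₀_mulVec {v : Q.Idx → ℂ} (hv : v ∈ Q.stateSpace) :
    Q.proj₀ *ᵥ v = ∑ x, v (Q.stateIdx x) • Q.stateKet x := by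
  ext i
  rw [proj₀, Matrix.mulVec_diagonal, Finset.sum_apply]
  simp only [Pi.smul_apply, stateKet, Pi.single_apply, smul_eq_mul]
  by_cases hi : ∃ x, i = Q.stateIdx x
  · obtain ⟨x, rfl⟩ := hi
    have h0 : ((Q.stateIdx x).2.1 : Fin d → ℝ) = 0 ∧ (Q.stateIdx x).2.2 = 0 :=
      ⟨sub_self _, rfl⟩
    simp only [h0, and_self, if_true, one_mul, stateIdx_inj, mul_ite, mul_one, mul_zero,
      Finset.sum_ite_eq, Finset.mem_univ]
  · push Not at hi
    simp only [hi, if_false, mul_zero, Finset.sum_const_zero, mul_eq_zero]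
    rw [ite_eq_right_iff, or_iff_not_imp_left]
    intro h0
    refine Q.mem_stateSpace.mp hv i fun hx => ?_
    obtain ⟨x, hix⟩ := Q.exists_eq_stateIdx hx (by tauto)
    exact hi x hix

theorem proj₀_mulVec_stateKet (x : C.Ω) : Q.proj₀ *ᵥ Q.stateKet x = Q.stateKet x := by
  have hx : Q.stateKet x ∈ Q.stateSpace :=
    Q.proposalSpace_le_stateSpace (Q.proposalKet_mem x x 0)
  rw [Q.proj₀_mulVec hx]
  simp only [stateKet, Pi.single_apply, stateIdx_inj, ite_smul, one_smul, zero_smul,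
    Finset.sum_ite_eq', Finset.mem_univ, if_true]

theorem prepare_mulVec_stateKet_apply_zero (x y z : C.Ω) :
    (Q.prepare *ᵥ Q.stateKet x) (Q.proposalIdx y z 0) =
      ((if y = x then √(C.T x z) * √(1 - C.acc x z) else 0 : ℝ) : ℂ) := by
  rw [prepare_mulVec_stateKet, Finset.sum_apply]
  simp [proposalKet, Pi.single_apply, proposalIdx_inj, ite_and, apply_ite Complex.ofReal]

theorem prepare_mulVec_stateKet_apply_one (x y z : C.Ω) :
    (Q.prepare *ᵥ Q.stateKet x) (Q.proposalIdx y z 1) =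
      ((if y = x then √(C.T x z) * √(C.acc x z) else 0 : ℝ) : ℂ) := by
  rw [prepare_mulVec_stateKet, Finset.sum_apply]
  simp [proposalKet, Pi.single_apply, proposalIdx_inj, ite_and, apply_ite Complex.ofReal]

theorem swap_mulVec_prepare_mulVec_stateKet (x : C.Ω) :
    Q.swap *ᵥ (Q.prepare *ᵥ Q.stateKet x) = ∑ y : C.Ω, ((√(C.T x y) : ℝ) : ℂ) •
      (((√(1 - C.acc x y) : ℝ) : ℂ) • Q.proposalKet x y 0 +
        ((√(C.acc x y) : ℝ) : ℂ) • Q.proposalKet y x 1) := by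
  rw [prepare_mulVec_stateKet, Matrix.mulVec_sum]
  simp only [Matrix.mulVec_smul, Matrix.mulVec_add, swap_mulVec_proposalKet_zero,
    swap_mulVec_proposalKet_one]

theorem star_prepare_mulVec_stateKet_dotProduct (x y z : C.Ω) :
    star (Q.prepare *ᵥ Q.stateKet y) ⬝ᵥ (((√(C.T x z) : ℝ) : ℂ) •
      (((√(1 - C.acc x z) : ℝ) : ℂ) • Q.proposalKet x z 0 +
        ((√(C.acc x z) : ℝ) : ℂ) • Q.proposalKet z x 1)) =
      (((if y = x then C.T y z * (1 - C.acc y z) else 0) +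
        if y = z then √(C.T y x * C.acc y x) * √(C.T x y * C.acc x y) else 0 : ℝ) : ℂ) := by
  simp only [dotProduct_smul, dotProduct_add, proposalKet, dotProduct_single_one, Pi.star_apply,
    prepare_mulVec_stateKet_apply_zero, prepare_mulVec_stateKet_apply_one, Complex.star_def,
    Complex.conj_ofReal, smul_eq_mul, ← Complex.ofReal_mul, ← Complex.ofReal_add]
  rw [mul_add]
  congr 2
  · rcases eq_or_ne x y with rfl | hxy
    · simp only [if_true]
      linear_combination √(1 - C.acc x z) ^ 2 * Real.sq_sqrt (C.T_mem x x.2 z z.2).1.le +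
        C.T x z * Real.sq_sqrt (sub_nonneg.mpr (MHChain.acc_le_one _ _))
    · simp only [hxy, hxy.symm, if_false, mul_zero]
  · rcases eq_or_ne z y with rfl | hzy
    · rw [if_pos rfl, if_pos rfl, Real.sqrt_mul (C.T_mem z z.2 x x.2).1.le,
        Real.sqrt_mul (C.T_mem x x.2 z z.2).1.le]
      ring
    · simp only [hzy, hzy.symm, if_false, mul_zero]

theorem core_mulVec_stateKet_apply (x y : C.Ω) :
    (Q.core *ᵥ Q.stateKet x) (Q.stateIdx y) = C.discriminant y x := by
  simp only [core_eq, ← Matrix.mulVec_mulVec]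
  rw [conjTranspose_mulVec_apply, ← stateKet, swap_mulVec_prepare_mulVec_stateKet, dotProduct_sum,
    Finset.sum_congr rfl fun z _ => Q.star_prepare_mulVec_stateKet_dotProduct x y z,
    ← Complex.ofReal_sum, Finset.sum_add_distrib, Finset.sum_ite_eq, if_pos (Finset.mem_univ y),
    Finset.sum_ite_irrel, Finset.sum_const_zero,
    Finset.sum_coe_sort C.Ω fun z => C.T y z * (1 - C.acc y z)]
  rfl

theorem proj₀_mulVec_core_mulVec_stateKet (x : C.Ω) :
    Q.proj₀ *ᵥ (Q.core *ᵥ Q.stateKet x) = ∑ y, (C.discriminant y x : ℂ) • Q.stateKet y := by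
  have hx : Q.stateKet x ∈ Q.spaceA := Q.spaceA_eq_span ▸ Submodule.subset_span ⟨x, rfl⟩
  simp only [Q.proj₀_mulVec (Q.core_mulVec_mem_stateSpace hx), core_mulVec_stateKet_apply]

/-- The encoding `∑ x, h x √P(x) |x⟩|0⟩|0⟩` of a function `h` on the states of the chain. The
weights are chosen such that the compression of `core` to `𝒜` becomes the transition matrix. -/
noncomputable def encode : (C.Ω → ℂ) →ₗ[ℂ] Q.Idx → ℂ :=
  Fintype.linearCombination ℂ fun x => ((√(C.P x) : ℝ) : ℂ) • Q.stateKet x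

theorem encode_apply (h : C.Ω → ℂ) :
    Q.encode h = ∑ x, h x • ((√(C.P x) : ℝ) : ℂ) • Q.stateKet x := rfl

theorem encode_one : Q.encode 1 = Q.ketP := by
  simp only [encode_apply, Pi.one_apply, one_smul, ← ket₃_zero]
  exact Finset.sum_coe_sort C.Ω fun x => ((√(C.P x) : ℝ) : ℂ) • ket₃ x 0 0

theorem encode_apply_stateIdx (h : C.Ω → ℂ) (x : C.Ω) :
    Q.encode h (Q.stateIdx x) = h x * ((√(C.P x) : ℝ) : ℂ) := by
  simp [encode_apply, Finset.sum_apply, stateKet, Pi.single_apply, stateIdx_inj]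

theorem encode_injective : Function.Injective Q.encode := by
  intro h h' hh
  ext x
  refine mul_right_cancel₀ (MHChain.ofReal_sqrt_P_ne_zero x.2) ?_
  rw [← encode_apply_stateIdx, hh, encode_apply_stateIdx]

theorem range_encode : LinearMap.range Q.encode = Q.spaceA := by
  rw [spaceA_eq_span]
  apply le_antisymm
  · rintro _ ⟨h, rfl⟩
    exact sum_mem fun x _ => Submodule.smul_mem _ _
      (Submodule.smul_mem _ _ (Submodule.subset_span ⟨x, rfl⟩))
  · rw [Submodule.span_le]
    rintro _ ⟨x, rfl⟩
    refine ⟨Pi.single x ((√(C.P x) : ℝ) : ℂ)⁻¹, ?_⟩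
    rw [encode, Fintype.linearCombination_apply_single,
      inv_smul_smul₀ (MHChain.ofReal_sqrt_P_ne_zero x.2)]

theorem proj₀_mulVec_core_mulVec_encode (h : C.Ω → ℂ) :
    Q.proj₀ *ᵥ (Q.core *ᵥ Q.encode h) = Q.encode (C.complexW *ᵥ h) := by
  have hdiscr (x y : C.Ω) : ((√(C.P x) : ℝ) : ℂ) * (C.discriminant y x : ℂ) =
      ((√(C.P y) : ℝ) : ℂ) * C.complexW y x := by
    rw [← Complex.ofReal_mul, MHChain.sqrt_P_mul_discriminant, Complex.ofReal_mul]
    rfl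
  simp only [encode_apply, Matrix.mulVec_sum, Matrix.mulVec_smul,
    proj₀_mulVec_core_mulVec_stateKet, Finset.smul_sum, smul_smul, mul_assoc, hdiscr]
  rw [Finset.sum_comm]
  refine Finset.sum_congr rfl fun y _ => ?_
  rw [← Finset.sum_smul, Matrix.mulVec, dotProduct, Finset.sum_mul]
  congr 1
  refine Finset.sum_congr rfl fun x _ => ?_
  ring

theorem isReflectionPair :
    IsReflectionPair Q.proj₀.mulVecLin Q.core.mulVecLin Q.spaceA where
  proj_apply a ha := by
    rw [spaceA_eq_span] at ha
    refine LinearMap.eqOn_span (f := Q.proj₀.mulVecLin) (g := LinearMap.id) ?_ ha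
    rintro _ ⟨x, rfl⟩
    exact Q.proj₀_mulVec_stateKet x
  proj_invol_mem a ha := by
    rw [← range_encode] at ha ⊢
    obtain ⟨h, rfl⟩ := ha
    exact ⟨_, (Q.proj₀_mulVec_core_mulVec_encode h).symm⟩
  invol_invol _ ha := Q.core_mulVec_core_mulVec ha

theorem U_mulVec (v : Q.Idx → ℂ) :
    Q.U *ᵥ v = reflectionWalk Q.proj₀.mulVecLin Q.core.mulVecLin v := by
  rw [U, opR, ← Matrix.mulVec_mulVec, Matrix.sub_mulVec, Matrix.smul_mulVec, Matrix.one_mulVec]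
  rfl

open scoped ComplexOrder in
theorem U_mulVec_eq_self_iff {v : Q.Idx → ℂ} (hv : v ∈ Q.spaceA ⊔ Q.spaceB) :
    Q.U *ᵥ v = v ↔ ∃ c : ℂ, v = c • Q.ketP := by
  rw [U_mulVec, Q.isReflectionPair.reflectionWalk_eq_self_iff
    (fun _ _ => mulVec_eq_self_of_isStarProjection Q.core_mem_unitaryGroup
      Q.isStarProjection_proj₀) hv, ← range_encode]
  constructor
  · rintro ⟨⟨h, rfl⟩, hh⟩
    obtain ⟨c, rfl⟩ := C.complexW_mulVec_eq_self_iff.mp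
      (Q.encode_injective ((Q.proj₀_mulVec_core_mulVec_encode h).symm.trans hh))
    exact ⟨c, by rw [map_smul, encode_one]⟩
  · rintro ⟨c, rfl⟩
    rw [← encode_one, ← map_smul]
    refine ⟨⟨_, rfl⟩, (Q.proj₀_mulVec_core_mulVec_encode _).trans ?_⟩
    rw [C.complexW_mulVec_eq_self_iff.mpr ⟨c, rfl⟩]

theorem arccos_one_sub_spectralGap_le {v : Q.Idx → ℂ} (hv : v ∈ Q.spaceA ⊔ Q.spaceB) (hv0 : v ≠ 0)
    {z : ℂ} (hz : z ≠ 1) (hU : Q.U *ᵥ v = z • v) {θ : ℝ} (hθ : z = Complex.exp (θ * Complex.I)) :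
    Real.arccos (1 - C.spectralGap) ≤ |θ| := by
  have hcos : (z + z⁻¹) / 2 = (Real.cos θ : ℂ) := by
    rw [hθ, Complex.ofReal_cos, Complex.cos, ← Complex.exp_neg, neg_mul]
  rw [U_mulVec] at hU
  by_cases hsq : z ^ 2 = 1
  · have hcos_eq : Real.cos θ = -1 := by
      have hz_half : (z + z⁻¹) / 2 = ((-1 : ℝ) : ℂ) := by
        rw [(sq_eq_one_iff.mp hsq).resolve_left hz]
        norm_num
      exact Complex.ofReal_injective (hcos.symm.trans hz_half)
    calc Real.arccos (1 - C.spectralGap) ≤ Real.arccos (-1) := by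
          rw [Real.arccos_neg_one]
          exact Real.arccos_le_pi _
      _ ≤ |θ| := arccos_le_abs_of_cos_le hcos_eq.le
  · obtain ⟨p, hp, hp0, hpW⟩ := Q.isReflectionPair.exists_compression_eigenvector hv hv0 hsq hU
    rw [← range_encode] at hp
    obtain ⟨h, rfl⟩ := hp
    have hWh : C.complexW *ᵥ h = (Real.cos θ : ℂ) • h := by
      refine Q.encode_injective ?_
      rw [map_smul, ← hcos, ← hpW, ← proj₀_mulVec_core_mulVec_encode]
      rfl
    have hcos_ne : (Real.cos θ : ℂ) ≠ 1 := fun h1 =>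
      hz (eq_one_of_half_add_inv_eq_one (hcos.trans h1))
    have hnorm : ‖(Real.cos θ : ℂ)‖ = |Real.cos θ| := Complex.norm_real _
    refine arccos_le_abs_of_cos_le ((le_abs_self _).trans (hnorm ▸ ?_))
    exact C.norm_le_one_sub_spectralGap (fun h0 => hp0 (by rw [h0, map_zero])) hcos_ne
      (hnorm ▸ Real.abs_cos_le_one θ) hWh

end WalkCircuit

/-- On `𝒜 + ℬ`, which `U` maps into itself, `|P⟩` spans the eigenspace of `U` for the eigenvalue
`1`, and any other eigenvalue is of the form `e^{iθ}` with real `θ`, where every such `θ` satisfies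
`|θ| ≥ arccos (1 - Δ)`. -/
theorem mainTheorem3 {d : ℕ} (C : MHChain d) (Q : WalkCircuit C) :
    (∀ v ∈ Q.spaceA ⊔ Q.spaceB, Q.U *ᵥ v ∈ Q.spaceA ⊔ Q.spaceB) ∧
    (Q.ketP ∈ Q.spaceA ⊔ Q.spaceB ∧ Q.ketP ≠ 0 ∧ Q.U *ᵥ Q.ketP = Q.ketP ∧
      ∀ v ∈ Q.spaceA ⊔ Q.spaceB, Q.U *ᵥ v = v → ∃ c : ℂ, v = c • Q.ketP) ∧
    (∀ z : ℂ, z ≠ 1 → (∃ v ∈ Q.spaceA ⊔ Q.spaceB, v ≠ 0 ∧ Q.U *ᵥ v = z • v) →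
      (∃ θ : ℝ, z = Complex.exp (θ * Complex.I)) ∧
      ∀ θ : ℝ, z = Complex.exp (θ * Complex.I) → Real.arccos (1 - C.spectralGap) ≤ |θ|) := by
  have hP : Q.ketP ∈ Q.spaceA ⊔ Q.spaceB :=
    Submodule.mem_sup_left (Q.range_encode ▸ ⟨1, Q.encode_one⟩)
  have hP0 : Q.ketP ≠ 0 := by
    rw [← Q.encode_one]
    exact (map_ne_zero_iff _ Q.encode_injective).mpr one_ne_zero
  refine ⟨fun v hv => ?_, ⟨hP, hP0, (Q.U_mulVec_eq_self_iff hP).mpr ⟨1, (one_smul ℂ _).symm⟩,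
    fun v hv => (Q.U_mulVec_eq_self_iff hv).mp⟩, ?_⟩
  · rw [Q.U_mulVec]
    exact Q.isReflectionPair.reflectionWalk_mem hv
  · rintro z hz ⟨v, hv, hv0, hUv⟩
    obtain ⟨θ, hθ⟩ := (Complex.norm_eq_one_iff z).mp
      (norm_eq_one_of_mulVec_eq_smul Q.U_mem_unitaryGroup hv0 hUv)
    exact ⟨⟨θ, hθ.symm⟩, fun _ => Q.arccos_one_sub_spectralGap_le hv hv0 hz hUv⟩
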